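/- Let $Cay$ be the real algebra of Cayley numbers (octonions), with basis $1=e_0,e_1,\dots,e_7$, where $e_i^2=-1$ for $i>0$, $e_ie_j=-e_je_i$ for distinct $i,j>0$, and $e_2e_6=e_3e_4=e_5e_7=e_1$ together with all relations obtained from this by cyclic permutation of the indices $1,\dots,7$; let $\overline{x}$ be the conjugate of $x$ and $|x|^2=x\overline{x}$. Let $P^2(Cay)=(Cay\times Cay)\sqcup\{(u):u\in Cay\}\sqcup\{(\infty)\}$ be the projective plane whose lines are the sets $[u,v]=\{(x,y):y=ux+v\}\cup\{(u)\}$, $[u]=\{(x,y):x=u\}\cup\{(\infty)\}$ and $[\infty]=\{(u):u\in Cay\}\cup\{(\infty)\}$. Let $\Pi$ be the hyperbolic polarity from points to lines given by $$\Pi(x,y)=[-\overline{xy^{-1}},\overline{y^{-1}}]\ (y\ne0),\qquad \Pi(x,0)=[\overline{x^{-1}}]\ (x\neq 0),\qquad \Pi(0,0)=[\infty],$$ $$\Pi(u)=[-\overline{u^{-1}},0]\ (u\neq0),\qquad \Pi(0)=[0]\ \text{for the point } (0) \text{ at infinity},\qquad \Pi(\infty)=[0,0].$$ Let $H^2(Cay)=\{(x,y)\in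 Cay\times Cay:|x|^2+|y|^2<1\}$, and let $G=Aut(H^2(Cay))=F_{4(-20)}$ be the group of collineations of $P^2(Cay)$ (bijections that preserve the set of lines) that commute with $\Pi$. Let $K$ be the stabilizer of $(0,0)$ in $G$. For every $t\in\mathbf{R}$ there is exactly one $a_t\in G$ such that, for all $(x_1,x_2)\in H^2(Cay)$, $$a_t(x_1,x_2)=\big((\cosh(t)x_1+\sinh(t))(\sinh(t)x_1+\cosh(t))^{-1},\ x_2(\sinh(t)x_1+\cosh(t))^{-1}\big).$$ Let $A=\{a_t:t\in\mathbf{R}\}$ be the split torus of the Iwasawa decomposition $G=KAN$, and let $M$ be the centralizer of $A$ in $K$, so that $MAN$ is the minimal parabolic subgroup of $G$. Then $M=Stab_K(1,0)$, the stabilizer in $K$ of the boundary point $(1,0)$. -/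

import Mathlib

namespace OctonionPlane

/-- The Cayley numbers (octonions): real combinations of the basis `e 0 = 1, e 1, ..., e 7`,
given by their coordinates. -/
def Cay : Type := Fin 8 → ℝ

namespace Cay

noncomputable instance : AddCommGroup Cay := inferInstanceAs (AddCommGroup (Fin 8 → ℝ))

noncomputable instance : Module ℝ Cay := inferInstanceAs (Module ℝ (Fin 8 → ℝ))

@[ext] theorem ext {x y : Cay} (h : ∀ i, x i = y i) : x = y := funext h

@[simp] theorem zero_apply (i : Fin 8) : (0 : Cay) i = 0 := rfl

@[simp] theorem add_apply (x y : Cay) (i : Fin 8) : (x + y) i = x i + y i := rfl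

@[simp] theorem neg_apply (x : Cay) (i : Fin 8) : (-x) i = -x i := rfl

@[simp] theorem sub_apply (x y : Cay) (i : Fin 8) : (x - y) i = x i - y i := rfl

@[simp] theorem smul_apply (t : ℝ) (x : Cay) (i : Fin 8) : (t • x) i = t * x i := rfl

/-- The basis vectors. -/
noncomputable def e (i : Fin 8) : Cay := fun j => if j = i then 1 else 0

noncomputable instance : One Cay := ⟨e 0⟩

/-- The octonion product in coordinates: the bilinear product with unit `e 0`, with
`e i * e i = -1` and `e i * e j = -(e j * e i)` for distinct `i, j > 0`, and with
`e 2 * e 6 = e 3 * e 4 = e 5 * e 7 = e 1` together with everything deduced from this by cyclic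
permutations of the indices `1, ..., 7` (see the lemmas after the ring structure). -/
noncomputable instance : Mul Cay := ⟨fun x y => ![
    x 0 * y 0 - x 1 * y 1 - x 2 * y 2 - x 3 * y 3 - x 4 * y 4 - x 5 * y 5 - x 6 * y 6 - x 7 * y 7,
    x 0 * y 1 + x 1 * y 0 + x 2 * y 6 + x 3 * y 4 - x 4 * y 3 + x 5 * y 7 - x 6 * y 2 - x 7 * y 5,
    x 0 * y 2 - x 1 * y 6 + x 2 * y 0 + x 3 * y 7 + x 4 * y 5 - x 5 * y 4 + x 6 * y 1 - x 7 * y 3,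
    x 0 * y 3 - x 1 * y 4 - x 2 * y 7 + x 3 * y 0 + x 4 * y 1 + x 5 * y 6 - x 6 * y 5 + x 7 * y 2,
    x 0 * y 4 + x 1 * y 3 - x 2 * y 5 - x 3 * y 1 + x 4 * y 0 + x 5 * y 2 + x 6 * y 7 - x 7 * y 6,
    x 0 * y 5 - x 1 * y 7 + x 2 * y 4 - x 3 * y 6 - x 4 * y 2 + x 5 * y 0 + x 6 * y 3 + x 7 * y 1,
    x 0 * y 6 + x 1 * y 2 - x 2 * y 1 + x 3 * y 5 - x 4 * y 7 - x 5 * y 3 + x 6 * y 0 + x 7 * y 4,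
    x 0 * y 7 + x 1 * y 5 + x 2 * y 3 - x 3 * y 2 + x 4 * y 6 - x 5 * y 1 - x 6 * y 4 + x 7 * y 0]⟩

theorem one_def : (1 : Cay) = e 0 := rfl

theorem mul_apply (x y : Cay) (i : Fin 8) : (x * y) i = ![
    x 0 * y 0 - x 1 * y 1 - x 2 * y 2 - x 3 * y 3 - x 4 * y 4 - x 5 * y 5 - x 6 * y 6 - x 7 * y 7,
    x 0 * y 1 + x 1 * y 0 + x 2 * y 6 + x 3 * y 4 - x 4 * y 3 + x 5 * y 7 - x 6 * y 2 - x 7 * y 5,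
    x 0 * y 2 - x 1 * y 6 + x 2 * y 0 + x 3 * y 7 + x 4 * y 5 - x 5 * y 4 + x 6 * y 1 - x 7 * y 3,
    x 0 * y 3 - x 1 * y 4 - x 2 * y 7 + x 3 * y 0 + x 4 * y 1 + x 5 * y 6 - x 6 * y 5 + x 7 * y 2,
    x 0 * y 4 + x 1 * y 3 - x 2 * y 5 - x 3 * y 1 + x 4 * y 0 + x 5 * y 2 + x 6 * y 7 - x 7 * y 6,
    x 0 * y 5 - x 1 * y 7 + x 2 * y 4 - x 3 * y 6 - x 4 * y 2 + x 5 * y 0 + x 6 * y 3 + x 7 * y 1,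
    x 0 * y 6 + x 1 * y 2 - x 2 * y 1 + x 3 * y 5 - x 4 * y 7 - x 5 * y 3 + x 6 * y 0 + x 7 * y 4,
    x 0 * y 7 + x 1 * y 5 + x 2 * y 3 - x 3 * y 2 + x 4 * y 6 - x 5 * y 1 - x 6 * y 4 + x 7 * y 0] i := rfl

noncomputable instance : NonAssocRing Cay where
  __ := (inferInstance : AddCommGroup Cay)
  left_distrib x y z := by
    ext i; fin_cases i <;> simp [mul_apply] <;> ring
  right_distrib x y z := by
    ext i; fin_cases i <;> simp [mul_apply] <;> ring
  zero_mul x := by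
    ext i; fin_cases i <;> simp [mul_apply]
  mul_zero x := by
    ext i; fin_cases i <;> simp [mul_apply]
  one_mul x := by
    ext i; fin_cases i <;> simp [mul_apply, one_def, e]
  mul_one x := by
    ext i; fin_cases i <;> simp [mul_apply, one_def, e]

theorem smul_mul (t : ℝ) (x y : Cay) : (t • x) * y = t • (x * y) := by
  ext i; fin_cases i <;> simp [mul_apply] <;> ring

theorem mul_smul (t : ℝ) (x y : Cay) : x * (t • y) = t • (x * y) := by
  ext i; fin_cases i <;> simp [mul_apply] <;> ring

theorem e_mul_self (i : Fin 7) : e i.succ * e i.succ = -1 := by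
  fin_cases i <;> ext j <;> fin_cases j <;> simp [mul_apply, one_def, e]

theorem mul_add_mul_comm {x y : Cay} (hx : x 0 = 0) (hy : y 0 = 0) :
    x * y + y * x = (-2 * ∑ i, x i * y i) • (1 : Cay) := by
  ext l
  fin_cases l <;> simp [mul_apply, one_def, e, Fin.sum_univ_eight, hx, hy] <;> ring

theorem e_anticomm (i j : Fin 7) (h : i ≠ j) : e i.succ * e j.succ = -(e j.succ * e i.succ) := by
  have hs : ∑ l, e i.succ l * e j.succ l = 0 := by
    simp [e, h.symm]
  have := mul_add_mul_comm (x := e i.succ) (y := e j.succ)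
    (if_neg (Fin.succ_ne_zero i).symm) (if_neg (Fin.succ_ne_zero j).symm)
  rw [hs, mul_zero, zero_smul] at this
  exact eq_neg_of_add_eq_zero_left this

/-- `e 2 * e 6 = e 3 * e 4 = e 5 * e 7 = e 1` and its cyclic permutations; here `k : Fin 7`
(with addition modulo 7) stands for the index `k + 1`. -/
theorem e_mul_e (k : Fin 7) :
    e (k + 1).succ * e (k + 5).succ = e k.succ ∧
    e (k + 2).succ * e (k + 3).succ = e k.succ ∧
    e (k + 4).succ * e (k + 6).succ = e k.succ := by
  fin_cases k <;> refine ⟨?_, ?_, ?_⟩ <;> ext j <;> fin_cases j <;> simp [mul_apply, e]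

/-- The conjugate of an octonion. -/
noncomputable def conj (x : Cay) : Cay := fun i => if i = 0 then x i else -x i

/-- The norm `N(x) = x * conj x`, a real number (the square of the modulus `|x|`). -/
noncomputable def normSq (x : Cay) : ℝ := ∑ i, x i ^ 2

theorem mul_conj (x : Cay) : x * conj x = normSq x • (1 : Cay) := by
  ext i
  fin_cases i <;> simp [mul_apply, conj, normSq, one_def, e, Fin.sum_univ_eight] <;> ring

/-- The inverse `conj x / N(x)` of a nonzero octonion (with value `0` at `0`). -/
noncomputable instance : Inv Cay := ⟨fun x => (normSq x)⁻¹ • conj x⟩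

theorem inv_def (x : Cay) : x⁻¹ = (normSq x)⁻¹ • conj x := rfl

end Cay

open Cay

/-- The points of the projective plane over the Cayley numbers: the points `(x, y)` at finite
distance, the points `(u)` at infinity, and the point `(∞)` at infinity. -/
inductive Point : Type
  | aff (x y : Cay) : Point
  | inf (u : Cay) : Point
  | infty : Point

/-- The oblique line `[u, v]`: the points with `y = u * x + v`, and `(u)`. -/
def oblique (u v : Cay) : Set Point :=
  {p | ∃ x : Cay, p = Point.aff x (u * x + v)} ∪ {Point.inf u}

/-- The vertical line `[u]`: the points with `x = u`, and `(∞)`. -/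
def vertical (u : Cay) : Set Point :=
  {p | ∃ y : Cay, p = Point.aff u y} ∪ {Point.infty}

/-- The line at infinity `[∞]`. -/
def lineAtInfinity : Set Point :=
  {p | ∃ u : Cay, p = Point.inf u} ∪ {Point.infty}

/-- The lines of the projective plane. -/
def IsLine (L : Set Point) : Prop :=
  (∃ u v, L = oblique u v) ∨ (∃ u, L = vertical u) ∨ L = lineAtInfinity

/-- A collineation: a bijection of the plane that preserves the set of lines. -/
def IsCollineation (g : Equiv.Perm Point) : Prop :=
  ∀ L : Set Point, IsLine (g '' L) ↔ IsLine L

open Classical in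
/-- The hyperbolic polarity. On points at finite distance, `(x, y)` goes to
`[-conj (x * y⁻¹), conj y⁻¹]` if `y ≠ 0`, `(x, 0)` to `[conj x⁻¹]` if `x ≠ 0`, and `(0, 0)` to the
line at infinity. The values at infinity are the ones forced by the symmetry
`a ∈ polar b ↔ b ∈ polar a`: `(u)` goes to `[-conj u⁻¹, 0]` if `u ≠ 0`, `(0)` to the line `x = 0`
and `(∞)` to the line `y = 0`. -/
noncomputable def polar : Point → Set Point
  | Point.aff x y =>
      if y ≠ 0 then oblique (-conj (x * y⁻¹)) (conj y⁻¹)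
      else if x ≠ 0 then vertical (conj x⁻¹)
      else lineAtInfinity
  | Point.inf u => if u ≠ 0 then oblique (-conj u⁻¹) 0 else vertical 0
  | Point.infty => oblique 0 0

/-- The hyperbolic plane `|x|² + |y|² < 1`, as a set of points of the projective plane. -/
def hyperbolicPlane : Set Point :=
  {p | ∃ x y : Cay, p = Point.aff x y ∧ normSq x + normSq y < 1}

/-- The automorphism group of the hyperbolic plane over the Cayley numbers: the
collineations of the projective plane that commute with the polarity. -/
noncomputable def G : Subgroup (Equiv.Perm Point) where
  carrier := {g | IsCollineation g ∧ ∀ p, g '' polar p = polar (g p)}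
  one_mem' := ⟨fun L => by simp, fun p => by simp⟩
  mul_mem' := by
    rintro g h ⟨hg, hg'⟩ ⟨hh, hh'⟩
    refine ⟨fun L => ?_, fun p => ?_⟩
    · rw [Equiv.Perm.coe_mul, Set.image_comp, hg, hh]
    · rw [Equiv.Perm.coe_mul, Set.image_comp, hh', hg', Function.comp_apply]
  inv_mem' := by
    rintro g ⟨hg, hg'⟩
    have key : ∀ L : Set Point, g '' ((g⁻¹ : Equiv.Perm Point) '' L) = L := fun L => by
      rw [← Set.image_comp, ← Equiv.Perm.coe_mul, mul_inv_cancel, Equiv.Perm.coe_one, Set.image_id]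
    refine ⟨fun L => ?_, fun p => ?_⟩
    · rw [← hg, key]
    · apply g.injective.image_injective
      rw [key, hg', ← Equiv.Perm.mul_apply, mul_inv_cancel, Equiv.Perm.one_apply]

/-- The subgroup `K`, the stabilizer of the origin `(0, 0)` in `G`. -/
noncomputable def K : Subgroup (Equiv.Perm Point) :=
  G ⊓ MulAction.stabilizer (Equiv.Perm Point) (Point.aff 0 0)

/-- `g` acts on the hyperbolic plane as the element `a_t` of the split torus, that is by
`(x₁, x₂) ↦ ((cosh t x₁ + sinh t)(sinh t x₁ + cosh t)⁻¹, x₂ (sinh t x₁ + cosh t)⁻¹)`. -/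
def ActsAsA (t : ℝ) (g : Equiv.Perm Point) : Prop :=
  ∀ x₁ x₂ : Cay, Point.aff x₁ x₂ ∈ hyperbolicPlane →
    g (Point.aff x₁ x₂) = Point.aff
      ((Real.cosh t • x₁ + Real.sinh t • (1 : Cay)) *
        (Real.sinh t • x₁ + Real.cosh t • (1 : Cay))⁻¹)
      (x₂ * (Real.sinh t • x₁ + Real.cosh t • (1 : Cay))⁻¹)

/-- The split torus `A = {a_t : t ∈ ℝ}` of the Iwasawa decomposition of `G`. -/
def A : Set (Equiv.Perm Point) := {g | g ∈ G ∧ ∃ t : ℝ, ActsAsA t g}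

/-- The subgroup `M` of the minimal parabolic subgroup: the centralizer of `A` in `K`. -/
noncomputable def M : Subgroup (Equiv.Perm Point) := K ⊓ Subgroup.centralizer A

end OctonionPlane

/-!
An element of `G` commutes with the polarity. If it fixes the origin it preserves the line at
infinity, the polar of the origin; if it also fixes a point `(x₀, 0)` with `x₀ ≠ 0`, it fixes
`(∞)`, where the polar of `(x₀, 0)` meets the line at infinity, hence the line `y = 0`, polar
to `(∞)`, and hence `(0)`. So it is an autotopism of the octonions
(`exists_autotopism_of_mem_G`): `(x, y) ↦ (α x, β y)`, `(u) ↦ (γ u)` with `α`, `β`, `γ` additive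
and `β (u x) = γ u * α x`. No continuity is assumed of collineations, and none is needed:
additivity replaces it throughout.

Existence of `a_t` rests on the identity
`(c x + s) (s x + c)⁻¹ = c / s - (1 / s) (s x + c)⁻¹` for `c ^ 2 - s ^ 2 = 1`, `s ≠ 0`: it writes
`a_t` as a product of real affine changes of `x` and of `(x, y) ↦ (x⁻¹, y x⁻¹)`, which exchanges
the lines `[u, v]` and `[v, u]`. These are collineations of the whole plane; the product maps
`[u, v]` to `[c u - s v, c v - s u]`, and comparing this with the polars shows that it commutes
with the polarity (`boost_image_polar`). For uniqueness, an element of `G` fixing the hyperbolic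
plane pointwise is an autotopism whose additive components are the identity near `0`, so it is
trivial (`eq_one_of_fixes_hyperbolicPlane`).

If `m ∈ K` centralizes `A`, it fixes `(tanh t, 0)`, the image of the origin under `a_t`. For
`tanh t = 1 / 2` this gives `α (1 / 2) = 1 / 2`, so `α 1 = 1` by additivity, and `m` fixes `(1, 0)`
(`stabilizer_of_mem_M`). Conversely let `m ∈ K` fix `(1, 0)`, that is `α 1 = 1`. Then `β = γ`,
`α` commutes with inversion, and compatibility with the polarity makes it commute with
conjugation. Thus `α` preserves the reals, where it is a ring endomorphism, hence the identity;
so `α` and `β` are real-linear and preserve the norm (`exists_linear_of_fixes`). Such an `m`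
preserves the hyperbolic plane and intertwines the formula for `a_t` with itself, and uniqueness
of `a_t` gives `m⁻¹ a_t m = a_t` (`mem_M_of_fixes`).
-/

namespace OctonionPlane

/-! ### Octonion arithmetic -/

namespace Cay

theorem conj_add (x y : Cay) : conj (x + y) = conj x + conj y := by
  ext i; fin_cases i <;> simp [conj] <;> ring

theorem conj_neg (x : Cay) : conj (-x) = -conj x := by
  ext i; fin_cases i <;> simp [conj]

theorem conj_smul (t : ℝ) (x : Cay) : conj (t • x) = t • conj x := by
  ext i; fin_cases i <;> simp [conj]

@[simp] theorem conj_zero : conj 0 = 0 := by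
  ext i; simp [conj]

@[simp] theorem conj_one : conj 1 = 1 := by
  ext i; fin_cases i <;> simp [conj, one_def, e]

@[simp] theorem conj_conj (x : Cay) : conj (conj x) = x := by
  ext i; fin_cases i <;> simp [conj]

theorem conj_mul (x y : Cay) : conj (x * y) = conj y * conj x := by
  ext i; fin_cases i <;> simp [conj, mul_apply] <;> ring

theorem normSq_nonneg (x : Cay) : 0 ≤ normSq x :=
  Finset.sum_nonneg fun _ _ => sq_nonneg _

@[simp] theorem normSq_zero : normSq 0 = 0 := by simp [normSq]

@[simp] theorem normSq_one : normSq 1 = 1 := by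
  simp [normSq, one_def, e]

theorem normSq_eq_zero {x : Cay} : normSq x = 0 ↔ x = 0 := by
  refine ⟨fun h => ?_, fun h => by simp [h]⟩
  ext i
  have := (Finset.sum_eq_zero_iff_of_nonneg (fun _ _ => sq_nonneg _)).1 h i (Finset.mem_univ i)
  simpa using this

theorem normSq_ne_zero {x : Cay} : normSq x ≠ 0 ↔ x ≠ 0 := normSq_eq_zero.not

theorem normSq_smul (t : ℝ) (x : Cay) : normSq (t • x) = t ^ 2 * normSq x := by
  simp [normSq, mul_pow, Finset.mul_sum]

theorem normSq_conj (x : Cay) : normSq (conj x) = normSq x := by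
  simp [normSq, conj, Fin.sum_univ_eight]

/-- The eight-square identity. -/
theorem normSq_mul (x y : Cay) : normSq (x * y) = normSq x * normSq y := by
  simp [normSq, mul_apply, Fin.sum_univ_eight]
  ring

/-- This and `conj_mul_mul` are the two alternative laws, in the form that yields cancellation
of inverses without associativity. -/
theorem mul_mul_conj (x y : Cay) : (x * y) * conj y = normSq y • x := by
  ext i
  fin_cases i <;> simp [conj, mul_apply, normSq, Fin.sum_univ_eight] <;> ring

theorem conj_mul_mul (x y : Cay) : conj x * (x * y) = normSq x • y := by
  ext i
  fin_cases i <;> simp [conj, mul_apply, normSq, Fin.sum_univ_eight] <;> ring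

theorem mul_mul_inv {y : Cay} (hy : y ≠ 0) (x : Cay) : (x * y) * y⁻¹ = x := by
  rw [inv_def, mul_smul, mul_mul_conj, smul_smul, inv_mul_cancel₀ (normSq_ne_zero.2 hy), one_smul]

theorem inv_mul_mul {x : Cay} (hx : x ≠ 0) (y : Cay) : x⁻¹ * (x * y) = y := by
  rw [inv_def, smul_mul, conj_mul_mul, smul_smul, inv_mul_cancel₀ (normSq_ne_zero.2 hx), one_smul]

@[simp] theorem inv_zero' : (0 : Cay)⁻¹ = 0 := by simp [inv_def]

@[simp] theorem inv_one' : (1 : Cay)⁻¹ = 1 := by simp [inv_def]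

theorem conj_inv_eq (x : Cay) : conj x⁻¹ = (conj x)⁻¹ := by
  rw [inv_def, inv_def, conj_smul, normSq_conj]

theorem inv_real_smul (t : ℝ) (x : Cay) : (t • x)⁻¹ = t⁻¹ • x⁻¹ := by
  rcases eq_or_ne t 0 with rfl | ht
  · simp
  rw [inv_def, inv_def, normSq_smul, conj_smul, smul_smul, smul_smul]
  congr 1
  field_simp

theorem normSq_inv (x : Cay) : normSq x⁻¹ = (normSq x)⁻¹ := by
  rcases eq_or_ne x 0 with rfl | hx
  · simp
  have := normSq_ne_zero.2 hx
  rw [inv_def, normSq_smul, normSq_conj]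
  field_simp

@[simp] theorem inv_eq_zero' {x : Cay} : x⁻¹ = 0 ↔ x = 0 := by
  rw [← normSq_eq_zero, normSq_inv, inv_eq_zero, normSq_eq_zero]

theorem conj_eq_zero {x : Cay} : conj x = 0 ↔ x = 0 := by
  rw [← normSq_eq_zero, normSq_conj, normSq_eq_zero]

@[simp] theorem inv_inv' (x : Cay) : x⁻¹⁻¹ = x := by
  rcases eq_or_ne x 0 with rfl | hx
  · simp
  have := normSq_ne_zero.2 hx
  rw [inv_def x⁻¹, normSq_inv, inv_inv, inv_def, conj_smul, conj_conj, smul_smul,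
    mul_inv_cancel₀ this, one_smul]

theorem mul_inv_rev' (x y : Cay) : (x * y)⁻¹ = y⁻¹ * x⁻¹ := by
  rw [inv_def, inv_def, inv_def, normSq_mul, conj_mul, smul_mul, mul_smul, smul_smul, mul_inv,
    mul_comm]

theorem mul_inv_mul {y : Cay} (hy : y ≠ 0) (x : Cay) : (x * y⁻¹) * y = x := by
  simpa using mul_mul_inv (y := y⁻¹) (by simpa using hy) x

theorem mul_inv_self {x : Cay} (hx : x ≠ 0) : x * x⁻¹ = 1 := by
  simpa using mul_mul_inv hx 1

theorem eq_of_mul_left_eq {x y z : Cay} (hx : x ≠ 0) (h : x * y = x * z) : y = z := by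
  rw [← inv_mul_mul hx y, h, inv_mul_mul hx]

theorem eq_smul_one_of_conj_eq {x : Cay} (h : conj x = x) : x = x 0 • (1 : Cay) := by
  have h' : ∀ i : Fin 8, i ≠ 0 → x i = 0 := fun i hi => by
    have := congrFun h i
    simp only [conj, hi, if_false] at this
    linarith
  ext i
  rcases eq_or_ne i 0 with rfl | hi
  · simp [one_def, e]
  · simp [one_def, e, h' i hi, hi]

theorem mul_real_smul_one (x : Cay) (t : ℝ) : x * (t • (1 : Cay)) = t • x := by
  rw [mul_smul, mul_one]

instance : Nontrivial Cay := ⟨⟨1, 0, normSq_ne_zero.1 (by simp)⟩⟩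

theorem mul_ne_zero_of_ne_zero {x y : Cay} (hx : x ≠ 0) (hy : y ≠ 0) : x * y ≠ 0 := by
  rw [← normSq_ne_zero, normSq_mul]
  exact mul_ne_zero (normSq_ne_zero.2 hx) (normSq_ne_zero.2 hy)

end Cay

open Cay

/-! ### Incidence and collineations -/

@[simp] theorem aff_mem_oblique {x y u v : Cay} : Point.aff x y ∈ oblique u v ↔ y = u * x + v := by
  simp [oblique]

@[simp] theorem inf_mem_oblique {w u v : Cay} : Point.inf w ∈ oblique u v ↔ w = u := by
  simp [oblique]

@[simp] theorem infty_notMem_oblique {u v : Cay} : Point.infty ∉ oblique u v := by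
  simp [oblique]

@[simp] theorem aff_mem_vertical {x y u : Cay} : Point.aff x y ∈ vertical u ↔ x = u := by
  simp [vertical, eq_comm]

@[simp] theorem inf_notMem_vertical {w u : Cay} : Point.inf w ∉ vertical u := by
  simp [vertical]

@[simp] theorem infty_mem_vertical {u : Cay} : Point.infty ∈ vertical u := by
  simp [vertical]

@[simp] theorem aff_notMem_lineAtInfinity {x y : Cay} : Point.aff x y ∉ lineAtInfinity := by
  simp [lineAtInfinity]

@[simp] theorem inf_mem_lineAtInfinity {w : Cay} : Point.inf w ∈ lineAtInfinity := by
  simp [lineAtInfinity]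

@[simp] theorem infty_mem_lineAtInfinity : Point.infty ∈ lineAtInfinity := by
  simp [lineAtInfinity]

theorem image_eq_of_mem_iff (g : Equiv.Perm Point) {L L' : Set Point}
    (h : ∀ p, g p ∈ L' ↔ p ∈ L) : g '' L = L' := by
  rw [← Equiv.eq_preimage_iff_image_eq]
  ext p
  exact (h p).symm

theorem isCollineation_of_forall {g : Equiv.Perm Point} (h : ∀ L, IsLine L → IsLine (g '' L))
    (h' : ∀ L, IsLine L → IsLine ((g⁻¹ : Equiv.Perm Point) '' L)) : IsCollineation g := by
  refine fun L => ⟨fun hL => ?_, h L⟩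
  have := h' _ hL
  rwa [← Set.image_comp, ← Equiv.Perm.coe_mul, inv_mul_cancel, Equiv.Perm.coe_one,
    Set.image_id] at this

theorem IsCollineation.mul {g h : Equiv.Perm Point} (hg : IsCollineation g)
    (hh : IsCollineation h) : IsCollineation (g * h) := fun L => by
  rw [Equiv.Perm.coe_mul, Set.image_comp, hg, hh]

/-- The collineation `(x, y) ↦ (k x + r, y)`, for real `k ≠ 0` and `r`. -/
noncomputable def affineShift (r k : ℝ) (hk : k ≠ 0) : Equiv.Perm Point where
  toFun
    | Point.aff x y => Point.aff (k • x + r • (1 : Cay)) y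
    | Point.inf u => Point.inf (k⁻¹ • u)
    | Point.infty => Point.infty
  invFun
    | Point.aff x y => Point.aff (k⁻¹ • (x - r • (1 : Cay))) y
    | Point.inf u => Point.inf (k • u)
    | Point.infty => Point.infty
  left_inv p := by rcases p with ⟨x, y⟩ | u | _ <;> simp [smul_smul, hk]
  right_inv p := by rcases p with ⟨x, y⟩ | u | _ <;> simp [smul_smul, hk]

section affineShift

variable (r k : ℝ) (hk : k ≠ 0)

@[simp] theorem affineShift_aff (x y : Cay) :
    affineShift r k hk (Point.aff x y) = Point.aff (k • x + r • (1 : Cay)) y := rfl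

@[simp] theorem affineShift_inf (u : Cay) :
    affineShift r k hk (Point.inf u) = Point.inf (k⁻¹ • u) := rfl

@[simp] theorem affineShift_infty : affineShift r k hk Point.infty = Point.infty := rfl

theorem affineShift_inv : (affineShift r k hk)⁻¹ = affineShift (-(r / k)) k⁻¹ (inv_ne_zero hk) := by
  rw [inv_eq_iff_mul_eq_one]
  ext p
  rcases p with ⟨x, y⟩ | u | _ <;>
    simp [Equiv.Perm.mul_apply, smul_smul, hk, mul_div_cancel₀]

theorem affineShift_image_oblique (u v : Cay) :
    affineShift r k hk '' oblique u v = oblique (k⁻¹ • u) (v - (r / k) • u) := by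
  refine image_eq_of_mem_iff _ fun p => ?_
  rcases p with ⟨x, y⟩ | w | _
  · have : (k⁻¹ • u) * (k • x + r • (1 : Cay)) + (v - (r / k) • u) = u * x + v := by
      rw [mul_add, mul_real_smul_one, smul_mul, Cay.mul_smul, smul_smul, smul_smul,
        inv_mul_cancel₀ hk, div_eq_mul_inv]
      module
    simp [this]
  · simp [hk]
  · simp

theorem affineShift_image_vertical (w : Cay) :
    affineShift r k hk '' vertical w = vertical (k • w + r • (1 : Cay)) := by
  refine image_eq_of_mem_iff _ fun p => ?_
  rcases p with ⟨x, y⟩ | w | _ <;> simp [hk]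

theorem affineShift_image_lineAtInfinity :
    affineShift r k hk '' lineAtInfinity = lineAtInfinity := by
  refine image_eq_of_mem_iff _ fun p => ?_
  rcases p with ⟨x, y⟩ | w | _ <;> simp

theorem affineShift_isCollineation : IsCollineation (affineShift r k hk) := by
  have key : ∀ (r k : ℝ) (hk : k ≠ 0) (L), IsLine L → IsLine (affineShift r k hk '' L) := by
    rintro r k hk L (⟨u, v, rfl⟩ | ⟨u, rfl⟩ | rfl)
    · exact Or.inl ⟨_, _, affineShift_image_oblique ..⟩
    · exact Or.inr (Or.inl ⟨_, affineShift_image_vertical ..⟩)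
    · exact Or.inr (Or.inr (affineShift_image_lineAtInfinity ..))
  refine isCollineation_of_forall (key r k hk) ?_
  rw [affineShift_inv]
  exact key _ _ _

end affineShift

open Classical in
/-- The map underlying `inversion`: `(x, y) ↦ (x⁻¹, y x⁻¹)` where `x ≠ 0`, with `(0, y) ↔ (y)`
and `(∞)` fixed. -/
noncomputable def inversionFun : Point → Point
  | Point.aff x y => if x = 0 then Point.inf y else Point.aff x⁻¹ (y * x⁻¹)
  | Point.inf u => Point.aff 0 u
  | Point.infty => Point.infty

/-- The involutive collineation `(x, y) ↦ (x⁻¹, y x⁻¹)`; it exchanges the line `x = 0` with the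
line at infinity. -/
noncomputable def inversion : Equiv.Perm Point :=
  Function.Involutive.toPerm inversionFun fun p => by
    rcases p with ⟨x, y⟩ | u | _
    · rcases eq_or_ne x 0 with rfl | hx
      · simp [inversionFun]
      · simp [inversionFun, hx, mul_inv_mul hx]
    · simp [inversionFun]
    · simp [inversionFun]

theorem inversion_inv : inversion⁻¹ = inversion := rfl

@[simp] theorem inversion_aff_zero (y : Cay) : inversion (Point.aff 0 y) = Point.inf y := by
  change inversionFun (Point.aff 0 y) = _
  simp [inversionFun]

theorem inversion_aff {x : Cay} (hx : x ≠ 0) (y : Cay) :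
    inversion (Point.aff x y) = Point.aff x⁻¹ (y * x⁻¹) := by
  change inversionFun (Point.aff x y) = _
  simp [inversionFun, hx]

@[simp] theorem inversion_inf (u : Cay) : inversion (Point.inf u) = Point.aff 0 u := rfl

@[simp] theorem inversion_infty : inversion Point.infty = Point.infty := rfl

theorem inversion_image_oblique (u v : Cay) : inversion '' oblique u v = oblique v u := by
  refine image_eq_of_mem_iff _ fun p => ?_
  rcases p with ⟨x, y⟩ | w | _
  · rcases eq_or_ne x 0 with rfl | hx
    · simp
    · have : y * x⁻¹ = v * x⁻¹ + u ↔ y = u * x + v := by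
        constructor
        · intro h
          rw [← mul_inv_mul hx y, h, add_mul, mul_inv_mul hx, add_comm]
        · rintro rfl
          rw [add_mul, mul_mul_inv hx, add_comm]
      simp [inversion_aff hx, this]
  · simp
  · simp

theorem inversion_image_vertical {w : Cay} (hw : w ≠ 0) :
    inversion '' vertical w = vertical w⁻¹ := by
  refine image_eq_of_mem_iff _ fun p => ?_
  rcases p with ⟨x, y⟩ | w' | _
  · rcases eq_or_ne x 0 with rfl | hx
    · simp [hw.symm]
    · have : x⁻¹ = w⁻¹ ↔ x = w :=
        ⟨fun h => by rw [← inv_inv' x, h, inv_inv'], fun h => by rw [h]⟩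
      simp [inversion_aff hx, this]
  · simpa [eq_comm] using hw
  · simp

theorem inversion_image_lineAtInfinity : inversion '' lineAtInfinity = vertical 0 := by
  refine image_eq_of_mem_iff _ fun p => ?_
  rcases p with ⟨x, y⟩ | w' | _
  · rcases eq_or_ne x 0 with rfl | hx
    · simp
    · simp [inversion_aff hx, hx]
  · simp
  · simp

theorem inversion_image_vertical_zero : inversion '' vertical 0 = lineAtInfinity := by
  rw [← inversion_image_lineAtInfinity, ← Set.image_comp, ← Equiv.Perm.coe_mul]
  nth_rewrite 1 [← inversion_inv]
  rw [inv_mul_cancel, Equiv.Perm.coe_one, Set.image_id]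

theorem inversion_isCollineation : IsCollineation inversion := by
  have key : ∀ L, IsLine L → IsLine (inversion '' L) := by
    rintro L (⟨u, v, rfl⟩ | ⟨u, rfl⟩ | rfl)
    · exact Or.inl ⟨_, _, inversion_image_oblique ..⟩
    · rcases eq_or_ne u 0 with rfl | hu
      · exact Or.inr (Or.inr inversion_image_vertical_zero)
      · exact Or.inr (Or.inl ⟨_, inversion_image_vertical hu⟩)
    · exact Or.inr (Or.inl ⟨_, inversion_image_lineAtInfinity⟩)
  exact isCollineation_of_forall key (by rwa [inversion_inv])

theorem polar_aff {x y : Cay} (hy : y ≠ 0) :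
    polar (Point.aff x y) = oblique (-conj (x * y⁻¹)) (conj y⁻¹) := by simp [polar, hy]

theorem polar_aff_zero {x : Cay} (hx : x ≠ 0) :
    polar (Point.aff x 0) = vertical (conj x⁻¹) := by simp [polar, hx]

@[simp] theorem polar_origin : polar (Point.aff 0 0) = lineAtInfinity := by simp [polar]

theorem polar_inf {u : Cay} (hu : u ≠ 0) :
    polar (Point.inf u) = oblique (-conj u⁻¹) 0 := by simp [polar, hu]

@[simp] theorem polar_inf_zero : polar (Point.inf 0) = vertical 0 := by simp [polar]

@[simp] theorem polar_infty : polar Point.infty = oblique 0 0 := rfl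

/-! ### The split torus -/

/-- For `s ≠ 0`, the collineation `(x, y) ↦ ((c x + s) (s x + c)⁻¹, y (s x + c)⁻¹)`, built from
the decomposition `(c x + s) (s x + c)⁻¹ = -(1 / s) (s x + c)⁻¹ + c / s`, which holds when
`c ^ 2 - s ^ 2 = 1`. Points with `s x + c = 0` go to infinity. -/
noncomputable def boost (c s : ℝ) (hs : s ≠ 0) : Equiv.Perm Point :=
  affineShift (c / s) (-s⁻¹) (neg_ne_zero.2 (inv_ne_zero hs)) * inversion * affineShift c s hs

section boost

variable {c s : ℝ} (hs : s ≠ 0)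

theorem boost_isCollineation : IsCollineation (boost c s hs) :=
  ((affineShift_isCollineation _ _ _).mul inversion_isCollineation).mul
    (affineShift_isCollineation _ _ _)

theorem mobius_eq (hs : s ≠ 0) (h : c ^ 2 - s ^ 2 = 1) {x : Cay} (hx : s • x + c • (1 : Cay) ≠ 0) :
    (c • x + s • (1 : Cay)) * (s • x + c • (1 : Cay))⁻¹ =
      -s⁻¹ • (s • x + c • (1 : Cay))⁻¹ + (c / s) • (1 : Cay) := by
  have : c • x + s • (1 : Cay) = (c / s) • (s • x + c • (1 : Cay)) + (-s⁻¹) • (1 : Cay) := by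
    match_scalars
    · field_simp
    · field_simp
      linear_combination -h
  nth_rewrite 1 [this]
  rw [add_mul, smul_mul, smul_mul, mul_inv_self hx, one_mul, add_comm]

theorem boost_aff (h : c ^ 2 - s ^ 2 = 1) {x : Cay} (hx : s • x + c • (1 : Cay) ≠ 0) (y : Cay) :
    boost c s hs (Point.aff x y) = Point.aff
      ((c • x + s • (1 : Cay)) * (s • x + c • (1 : Cay))⁻¹) (y * (s • x + c • (1 : Cay))⁻¹) := by
  rw [mobius_eq hs h hx]
  simp [boost, Equiv.Perm.mul_apply, inversion_aff hx]

theorem boost_aff_of_eq_zero {x : Cay} (hx : s • x + c • (1 : Cay) = 0) (y : Cay) :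
    boost c s hs (Point.aff x y) = Point.inf (-s • y) := by
  simp [boost, Equiv.Perm.mul_apply, hx, inv_neg]

theorem boost_inf (u : Cay) :
    boost c s hs (Point.inf u) = Point.aff ((c / s) • (1 : Cay)) (s⁻¹ • u) := by
  simp [boost, Equiv.Perm.mul_apply]

@[simp] theorem boost_infty : boost c s hs Point.infty = Point.infty := by
  simp [boost, Equiv.Perm.mul_apply]

theorem boost_image_oblique (h : c ^ 2 - s ^ 2 = 1) (u v : Cay) :
    boost c s hs '' oblique u v = oblique (c • u - s • v) (c • v - s • u) := by
  rw [boost, Equiv.Perm.coe_mul, Equiv.Perm.coe_mul, Set.image_comp, affineShift_image_oblique,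
    Set.image_comp, inversion_image_oblique, affineShift_image_oblique]
  congr 1
  · match_scalars <;> field_simp
  · match_scalars
    · field_simp
      linear_combination -h
    · field_simp

theorem boost_image_vertical (h : c ^ 2 - s ^ 2 = 1) {w : Cay} (hw : s • w + c • (1 : Cay) ≠ 0) :
    boost c s hs '' vertical w =
      vertical ((c • w + s • (1 : Cay)) * (s • w + c • (1 : Cay))⁻¹) := by
  rw [boost, Equiv.Perm.coe_mul, Equiv.Perm.coe_mul, Set.image_comp, affineShift_image_vertical,
    Set.image_comp, inversion_image_vertical hw, affineShift_image_vertical, mobius_eq hs h hw]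

theorem boost_image_vertical_of_eq_zero {w : Cay} (hw : s • w + c • (1 : Cay) = 0) :
    boost c s hs '' vertical w = lineAtInfinity := by
  rw [boost, Equiv.Perm.coe_mul, Equiv.Perm.coe_mul, Set.image_comp, affineShift_image_vertical,
    Set.image_comp, hw, inversion_image_vertical_zero, affineShift_image_lineAtInfinity]

theorem boost_image_lineAtInfinity :
    boost c s hs '' lineAtInfinity = vertical ((c / s) • (1 : Cay)) := by
  rw [boost, Equiv.Perm.coe_mul, Equiv.Perm.coe_mul, Set.image_comp,
    affineShift_image_lineAtInfinity, Set.image_comp, inversion_image_lineAtInfinity,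
    affineShift_image_vertical]
  simp

theorem conj_mobius (hs : s ≠ 0) (h : c ^ 2 - s ^ 2 = 1)
    {x : Cay} (hx : s • x + c • (1 : Cay) ≠ 0) :
    conj ((c • x + s • (1 : Cay)) * (s • x + c • (1 : Cay))⁻¹) =
      (c • conj x + s • (1 : Cay)) * (s • conj x + c • (1 : Cay))⁻¹ := by
  have e : s • conj x + c • (1 : Cay) = conj (s • x + c • (1 : Cay)) := by
    simp [conj_add, conj_smul]
  rw [mobius_eq hs h hx, mobius_eq hs h (by rwa [e, Ne, conj_eq_zero]), e]
  simp [conj_add, conj_neg, conj_smul, conj_inv_eq]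

/-- The Möbius map `z ↦ (c z + s) (s z + c)⁻¹` commutes with inversion. -/
theorem mobius_inv {z : Cay} (hz : z ≠ 0) :
    (c • z⁻¹ + s • (1 : Cay)) * (s • z⁻¹ + c • (1 : Cay))⁻¹ =
      ((c • z + s • (1 : Cay)) * (s • z + c • (1 : Cay))⁻¹)⁻¹ := by
  have e : s • z⁻¹ + c • (1 : Cay) = (c • z + s • (1 : Cay)) * z⁻¹ := by
    rw [add_mul, smul_mul, smul_mul, mul_inv_self hz, one_mul, add_comm]
  rw [mul_inv_rev', inv_inv', e, mul_inv_rev', inv_inv', add_mul, add_mul, smul_mul, smul_mul,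
    smul_mul, smul_mul, inv_mul_mul hz, one_mul, one_mul, add_comm]

/-- The torus commutes with the polarity. Both sides are computed as explicit lines; the cases
record which of the points and lines involved are sent to infinity. -/
theorem boost_image_polar (h : c ^ 2 - s ^ 2 = 1) (hc : c ≠ 0) (p : Point) :
    boost c s hs '' polar p = polar (boost c s hs p) := by
  rcases p with ⟨x, y⟩ | u | _
  · rcases eq_or_ne (s • x + c • (1 : Cay)) 0 with hd | hd
    · rw [boost_aff_of_eq_zero hs hd]
      have hx : x = (-(c / s)) • (1 : Cay) := by
        have : s⁻¹ • (s • x + c • (1 : Cay)) = 0 := by rw [hd, smul_zero]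
        rw [smul_add, smul_smul, smul_smul, inv_mul_cancel₀ hs, one_smul] at this
        rw [eq_neg_of_add_eq_zero_left this, neg_smul, div_eq_inv_mul]
      rcases eq_or_ne y 0 with rfl | hy
      · have hx0 : x ≠ 0 := by
          rintro rfl
          simp [hc] at hd
        rw [polar_aff_zero hx0, smul_zero, polar_inf_zero]
        have e : conj x⁻¹ = (-(s / c)) • (1 : Cay) := by
          rw [hx, inv_real_smul, conj_smul, inv_one', conj_one, inv_neg, inv_div]
        have hne : s • conj x⁻¹ + c • (1 : Cay) ≠ 0 := by
          rw [e, smul_smul, ← add_smul]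
          refine smul_ne_zero ?_ one_ne_zero
          have : s * -(s / c) + c = c⁻¹ := by
            field_simp
            linear_combination h
          rw [this]
          exact inv_ne_zero hc
        rw [boost_image_vertical hs h hne]
        have : c • conj x⁻¹ + s • (1 : Cay) = 0 := by
          rw [e, smul_smul, ← add_smul]
          have : c * -(s / c) + s = 0 := by field_simp; ring
          rw [this, zero_smul]
        rw [this, zero_mul]
      · have hy' : (-s) • y ≠ 0 := smul_ne_zero (neg_ne_zero.2 hs) hy
        rw [polar_aff hy, polar_inf hy', boost_image_oblique hs h, hx, smul_mul, one_mul,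
          inv_real_smul, conj_smul, conj_smul]
        congr 1
        · match_scalars
          field_simp
          linear_combination h
        · match_scalars
          field_simp
          ring
    · rw [boost_aff hs h hd]
      rcases eq_or_ne y 0 with rfl | hy
      · rw [zero_mul]
        rcases eq_or_ne x 0 with rfl | hx
        · rw [polar_origin, boost_image_lineAtInfinity, polar_aff_zero]
          · simp [inv_real_smul, Cay.mul_smul, conj_smul, smul_smul, div_eq_inv_mul]
          · simp [inv_real_smul, Cay.mul_smul, hs, hc]
        · rw [polar_aff_zero hx]
          have hx' : conj x ≠ 0 := by rwa [Ne, conj_eq_zero]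
          have e : s • conj x⁻¹ + c • (1 : Cay) = (conj (c • x + s • (1 : Cay))) * (conj x)⁻¹ := by
            rw [conj_add, conj_smul, conj_smul, conj_one, add_mul, smul_mul, smul_mul,
              mul_inv_self hx', one_mul, conj_inv_eq, add_comm]
          rcases eq_or_ne (c • x + s • (1 : Cay)) 0 with hn | hn
          · rw [hn, zero_mul, polar_origin, boost_image_vertical_of_eq_zero]
            rw [e, hn, conj_zero, zero_mul]
          · rw [polar_aff_zero (mul_ne_zero_of_ne_zero hn (by rwa [Ne, inv_eq_zero'])),
              boost_image_vertical hs h,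
              conj_inv_eq, conj_inv_eq, conj_mobius hs h hd, mobius_inv hx']
            rw [e]
            exact mul_ne_zero_of_ne_zero (by rwa [Ne, conj_eq_zero]) (by rwa [Ne, inv_eq_zero'])
      · have hy' : y * (s • x + c • (1 : Cay))⁻¹ ≠ 0 := by
          rw [← normSq_ne_zero, normSq_mul, normSq_inv]
          exact mul_ne_zero (normSq_ne_zero.2 hy) (inv_ne_zero (normSq_ne_zero.2 hd))
        rw [polar_aff hy, polar_aff hy', boost_image_oblique hs h, mul_inv_rev', inv_inv']
        have e₁ : (s • x + c • (1 : Cay)) * y⁻¹ = s • (x * y⁻¹) + c • y⁻¹ := by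
          rw [add_mul, smul_mul, smul_mul, one_mul]
        have e₂ : ((c • x + s • (1 : Cay)) * (s • x + c • (1 : Cay))⁻¹) *
            ((s • x + c • (1 : Cay)) * y⁻¹) = c • (x * y⁻¹) + s • y⁻¹ := by
          rw [mobius_eq hs h hd, add_mul, smul_mul, smul_mul, inv_mul_mul hd, one_mul, e₁]
          match_scalars
          · field_simp
            linear_combination h
          · field_simp
        rw [e₂, e₁]
        simp only [conj_add, conj_smul]
        congr 1 <;> module
  · rw [boost_inf]
    rcases eq_or_ne u 0 with rfl | hu
    · have h0 : s • (0 : Cay) + c • (1 : Cay) ≠ 0 := by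
        simpa using hc
      rw [polar_inf_zero, boost_image_vertical hs h h0, smul_zero s⁻¹, polar_aff_zero]
      · simp [inv_real_smul, Cay.mul_smul, conj_smul, smul_smul, div_eq_mul_inv, mul_comm]
      · exact smul_ne_zero (div_ne_zero hc hs) one_ne_zero
    · rw [polar_inf hu, polar_aff (smul_ne_zero (inv_ne_zero hs) hu), boost_image_oblique hs h,
        inv_real_smul, inv_inv, smul_mul, one_mul, smul_smul, conj_smul, conj_smul,
        div_mul_cancel₀ _ hs]
      congr 1 <;> module
  · rw [boost_infty, polar_infty, boost_image_oblique hs h]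
    simp

theorem boost_mem_G (h : c ^ 2 - s ^ 2 = 1) (hc : c ≠ 0) : boost c s hs ∈ G :=
  ⟨boost_isCollineation hs, boost_image_polar hs h hc⟩

end boost

theorem smul_add_smul_one_ne_zero {c s : ℝ} (h : c ^ 2 - s ^ 2 = 1) {x : Cay} (hx : normSq x < 1) :
    s • x + c • (1 : Cay) ≠ 0 := by
  intro h0
  have h1 : s • x = (-c) • (1 : Cay) := by rw [neg_smul]; exact eq_neg_of_add_eq_zero_left h0
  have h2 := congrArg normSq h1
  rw [normSq_smul, normSq_smul, normSq_one] at h2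
  nlinarith [mul_le_mul_of_nonneg_left hx.le (sq_nonneg s)]

theorem exists_actsAsA (t : ℝ) : ∃ a ∈ G, ActsAsA t a := by
  rcases eq_or_ne (Real.sinh t) 0 with hs | hs
  · rw [Real.sinh_eq_zero] at hs
    subst hs
    exact ⟨1, one_mem _, fun x y _ => by simp⟩
  · have h := Real.cosh_sq_sub_sinh_sq t
    refine ⟨boost (Real.cosh t) (Real.sinh t) hs, boost_mem_G hs h (Real.cosh_pos t).ne', ?_⟩
    rintro x y ⟨x', y', hxy, hlt⟩
    obtain ⟨rfl, rfl⟩ := Point.aff.inj hxy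
    exact boost_aff hs h (smul_add_smul_one_ne_zero h (by linarith [normSq_nonneg y])) y

/-! ### Stabilizers of triangles and autotopisms -/

/-- A collineation fixing the triangle `(0, 0)`, `(0)`, `(∞)` is an autotopism of the octonions:
it acts on each of the three coordinates separately, and the coordinate maps intertwine the
multiplication and are additive. -/
theorem exists_autotopism {g : Equiv.Perm Point} (hg : IsCollineation g)
    (hl : g '' lineAtInfinity = lineAtInfinity) (h0 : g (Point.aff 0 0) = Point.aff 0 0)
    (hi0 : g (Point.inf 0) = Point.inf 0) (hi : g Point.infty = Point.infty) :
    ∃ α β γ : Cay →+ Cay, (∀ x y, g (Point.aff x y) = Point.aff (α x) (β y)) ∧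
      (∀ u, g (Point.inf u) = Point.inf (γ u)) ∧ ∀ u x, β (u * x) = γ u * α x := by
  have mem_iff : ∀ p, g p ∈ lineAtInfinity ↔ p ∈ lineAtInfinity := fun p => by
    conv_lhs => rw [← hl]
    exact g.injective.mem_set_image
  have haff : ∀ x y, ∃ x' y', g (Point.aff x y) = Point.aff x' y' := fun x y => by
    have := (mem_iff (Point.aff x y)).not.2 (by simp)
    rcases hp : g (Point.aff x y) with ⟨x', y'⟩ | u | _
    · exact ⟨x', y', rfl⟩
    · simp [hp] at this
    · simp [hp] at this
  have hinf : ∀ u, ∃ u', g (Point.inf u) = Point.inf u' := fun u => by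
    have := (mem_iff (Point.inf u)).2 (by simp)
    rcases hp : g (Point.inf u) with ⟨x', y'⟩ | u' | _
    · simp [hp] at this
    · exact ⟨u', rfl⟩
    · have := g.injective (hp.trans hi.symm)
      simp at this
  choose φ ψ hφ using haff
  choose γ hγ using hinf
  have hvert : ∀ w, g '' vertical w = vertical (φ w 0) := fun w => by
    have hmem : Point.aff (φ w 0) (ψ w 0) ∈ g '' vertical w := ⟨Point.aff w 0, by simp, hφ w 0⟩
    have hinfty : Point.infty ∈ g '' vertical w := ⟨Point.infty, by simp, hi⟩
    rcases (hg (vertical w)).2 (Or.inr (Or.inl ⟨w, rfl⟩)) with ⟨u, v, h⟩ | ⟨u, h⟩ | h <;>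
      rw [h] at hmem hinfty
    · simp at hinfty
    · rw [h, aff_mem_vertical.1 hmem]
    · simp at hmem
  have hφ1 : ∀ x y, φ x y = φ x 0 := fun x y => by
    have : g (Point.aff x y) ∈ g '' vertical x := ⟨_, by simp, rfl⟩
    rwa [hvert, hφ, aff_mem_vertical] at this
  have h00 : φ 0 0 = 0 ∧ ψ 0 0 = 0 := by
    have := (hφ 0 0).symm.trans h0
    simpa using this
  have hγ0 : γ 0 = 0 := by simpa using (hγ 0).symm.trans hi0
  have hobl : ∀ u v, g '' oblique u v = oblique (γ u) (ψ 0 v) := fun u v => by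
    have hmem : Point.aff 0 (ψ 0 v) ∈ g '' oblique u v :=
      ⟨Point.aff 0 v, by simp, by rw [hφ, hφ1, h00.1]⟩
    have hinf' : Point.inf (γ u) ∈ g '' oblique u v := ⟨Point.inf u, by simp, hγ u⟩
    rcases (hg (oblique u v)).2 (Or.inl ⟨u, v, rfl⟩) with ⟨u', v', h⟩ | ⟨u', h⟩ | h <;>
      rw [h] at hmem hinf'
    · rw [h, inf_mem_oblique.1 hinf', aff_mem_oblique.1 hmem]
      simp
    · simp at hinf'
    · simp at hmem
  have hψ : ∀ x y, ψ x y = ψ 0 y := fun x y => by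
    have : g (Point.aff x y) ∈ g '' oblique 0 y := ⟨_, by simp, rfl⟩
    rw [hobl, hφ, aff_mem_oblique] at this
    simpa [hγ0] using this
  have key : ∀ u x v, ψ 0 (u * x + v) = γ u * φ x 0 + ψ 0 v := fun u x v => by
    have : g (Point.aff x (u * x + v)) ∈ g '' oblique u v := ⟨_, by simp, rfl⟩
    rwa [hobl, hφ, aff_mem_oblique, hφ1, hψ] at this
  have hmul : ∀ u x, ψ 0 (u * x) = γ u * φ x 0 := fun u x => by
    simpa [h00.2] using key u x 0
  have hadd : ∀ y y', ψ 0 (y + y') = ψ 0 y + ψ 0 y' := fun y y' => by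
    have := key y 1 y'
    rwa [← hmul, mul_one] at this
  have hγ1 : γ 1 ≠ 0 := fun h => by
    have : g (Point.inf 1) = g (Point.inf 0) := by rw [hγ, hγ, h, hγ0]
    simpa using g.injective this
  have hφ10 : φ 1 0 ≠ 0 := fun h => by
    have : g (Point.aff 1 0) = g (Point.aff 0 0) := by rw [hφ, hφ, hψ 1, h, h00.1]
    simpa using g.injective this
  have hφadd : ∀ x x', φ (x + x') 0 = φ x 0 + φ x' 0 := fun x x' => by
    apply eq_of_mul_left_eq hγ1
    rw [mul_add, ← hmul, ← hmul, ← hmul, mul_add, hadd]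
  have hγadd : ∀ u u', γ (u + u') = γ u + γ u' := fun u u' => by
    rw [← mul_mul_inv hφ10 (γ (u + u')), ← hmul, add_mul, hadd, hmul, hmul, add_mul,
      mul_mul_inv hφ10, mul_mul_inv hφ10]
  refine ⟨AddMonoidHom.mk' (fun x => φ x 0) hφadd, AddMonoidHom.mk' (ψ 0) hadd,
    AddMonoidHom.mk' γ hγadd, fun x y => ?_, hγ, hmul⟩
  rw [hφ, hφ1, hψ]
  rfl

/-- An automorphism fixing the origin and a second point of the line `y = 0` is an autotopism:
its commutation with the polarity makes it fix the third vertices of the triangle too. -/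
theorem exists_autotopism_of_mem_G {g : Equiv.Perm Point} (hg : g ∈ G)
    (h0 : g (Point.aff 0 0) = Point.aff 0 0) {x₀ : Cay} (hx₀ : x₀ ≠ 0)
    (h : g (Point.aff x₀ 0) = Point.aff x₀ 0) :
    ∃ α β γ : Cay →+ Cay, (∀ x y, g (Point.aff x y) = Point.aff (α x) (β y)) ∧
      (∀ u, g (Point.inf u) = Point.inf (γ u)) ∧ ∀ u x, β (u * x) = γ u * α x := by
  have hl : g '' lineAtInfinity = lineAtInfinity := by
    have := hg.2 (Point.aff 0 0)
    rwa [h0, polar_origin] at this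
  have hv : g '' vertical (conj x₀⁻¹) = vertical (conj x₀⁻¹) := by
    have := hg.2 (Point.aff x₀ 0)
    rwa [h, polar_aff_zero hx₀] at this
  have fixed_of_mem : ∀ {L L' : Set Point} {p : Point}, g '' L = L → g '' L' = L' → p ∈ L → p ∈ L' →
      g p ∈ L ∧ g p ∈ L' := by
    intro L L' p hL hL' hp hp'
    constructor
    · rw [← hL]; exact ⟨p, hp, rfl⟩
    · rw [← hL']; exact ⟨p, hp', rfl⟩
  have hi : g Point.infty = Point.infty := by
    have := fixed_of_mem hl hv (p := Point.infty) (by simp) (by simp)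
    rcases hp : g Point.infty with ⟨x, y⟩ | u | _
    · simp [hp] at this
    · simp [hp] at this
    · rfl
  have ho : g '' oblique 0 0 = oblique 0 0 := by
    have := hg.2 Point.infty
    rwa [hi, polar_infty] at this
  have hi0 : g (Point.inf 0) = Point.inf 0 := by
    have := fixed_of_mem hl ho (p := Point.inf 0) (by simp) (by simp)
    rcases hp : g (Point.inf 0) with ⟨x, y⟩ | u | _
    · simp [hp] at this
    · simpa [hp] using this
    · simp [hp] at this
  exact exists_autotopism hg.1 hl h0 hi0 hi

theorem aff_mem_hyperbolicPlane {x y : Cay} :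
    Point.aff x y ∈ hyperbolicPlane ↔ normSq x + normSq y < 1 := by
  simp only [hyperbolicPlane, Set.mem_ofPred_eq, Point.aff.injEq]
  exact ⟨by rintro ⟨_, _, ⟨rfl, rfl⟩, h⟩; exact h, fun h => ⟨_, _, ⟨rfl, rfl⟩, h⟩⟩

theorem half_smul_one_mem : Point.aff ((1 / 2 : ℝ) • (1 : Cay)) 0 ∈ hyperbolicPlane := by
  rw [aff_mem_hyperbolicPlane, normSq_smul]
  norm_num

theorem half_smul_one_ne_zero : (1 / 2 : ℝ) • (1 : Cay) ≠ 0 := by simp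

/-- An additive map that is the identity on the unit ball is the identity, as `x` is a natural
multiple of `x / n`. -/
theorem eq_id_of_fixes_unit_ball {f : Cay →+ Cay} (hf : ∀ x, normSq x < 1 → f x = x) (x : Cay) :
    f x = x := by
  obtain ⟨n, hn⟩ := exists_nat_gt (normSq x)
  have hx := normSq_nonneg x
  have hn0 : (0 : ℝ) < n := hx.trans_lt hn
  have hn1 : (1 : ℝ) ≤ n := by exact_mod_cast Nat.cast_pos.1 hn0
  have hsmall : normSq ((n : ℝ)⁻¹ • x) < 1 := by
    rw [normSq_smul, inv_pow, inv_mul_lt_one₀ (by positivity)]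
    nlinarith
  have e : x = n • ((n : ℝ)⁻¹ • x) := by
    rw [← Nat.cast_smul_eq_nsmul ℝ, smul_smul, mul_inv_cancel₀ hn0.ne', one_smul]
  rw [e, map_nsmul, hf _ hsmall]

/-- An automorphism is determined by its action on the hyperbolic plane. -/
theorem eq_one_of_fixes_hyperbolicPlane {g : Equiv.Perm Point} (hg : g ∈ G)
    (h : ∀ p ∈ hyperbolicPlane, g p = p) : g = 1 := by
  have h0 : g (Point.aff 0 0) = Point.aff 0 0 := h _ (aff_mem_hyperbolicPlane.2 (by simp))
  obtain ⟨α, β, γ, haff, hinf, hmul⟩ :=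
    exists_autotopism_of_mem_G hg h0 half_smul_one_ne_zero (h _ half_smul_one_mem)
  have hα : ∀ x, α x = x := eq_id_of_fixes_unit_ball fun x hx => by
    have := (haff x 0).symm.trans (h _ (aff_mem_hyperbolicPlane.2 (by simpa using hx)))
    exact (Point.aff.inj this).1
  have hβ : ∀ y, β y = y := eq_id_of_fixes_unit_ball fun y hy => by
    have := (haff 0 y).symm.trans (h _ (aff_mem_hyperbolicPlane.2 (by simpa using hy)))
    exact (Point.aff.inj this).2
  have hγ : ∀ u, γ u = u := fun u => by
    have := hmul u 1
    rw [hα, mul_one, mul_one, hβ] at this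
    exact this.symm
  ext p
  rcases p with ⟨x, y⟩ | u | _
  · rw [haff, hα, hβ, Equiv.Perm.one_apply]
  · rw [hinf, hγ, Equiv.Perm.one_apply]
  · rcases hp : g Point.infty with ⟨x, y⟩ | u | _
    · have := g.injective (hp.trans (by rw [haff, hα, hβ] : g (Point.aff x y) = _).symm)
      simp at this
    · have := g.injective (hp.trans (by rw [hinf, hγ] : g (Point.inf u) = _).symm)
      simp at this
    · rfl

theorem ActsAsA.unique {t : ℝ} {a b : Equiv.Perm Point} (ha : a ∈ G) (hb : b ∈ G)
    (hat : ActsAsA t a) (hbt : ActsAsA t b) : a = b := by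
  rw [← inv_mul_eq_one]
  refine eq_one_of_fixes_hyperbolicPlane (mul_mem (inv_mem ha) hb) fun p hp => ?_
  obtain ⟨x, y, rfl, h⟩ := id hp
  rw [Equiv.Perm.mul_apply, hbt x y hp, ← hat x y hp, Equiv.Perm.inv_def, Equiv.symm_apply_apply]

/-! ### The centralizer of the torus -/

theorem stabilizer_of_mem_M {m : Equiv.Perm Point} (hm : m ∈ M) :
    m (Point.aff 1 0) = Point.aff 1 0 := by
  obtain ⟨⟨hG, h0⟩, hc⟩ := hm
  replace h0 : m (Point.aff 0 0) = Point.aff 0 0 := h0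
  obtain ⟨a, ha, hat⟩ := exists_actsAsA (Real.artanh (1 / 2))
  have hcomm : a * m = m * a := hc a ⟨ha, _, hat⟩
  -- `a` moves the origin to `(tanh t, 0) = (1 / 2, 0)`, which `m` therefore fixes.
  have ha0 : a (Point.aff 0 0) = Point.aff ((1 / 2 : ℝ) • (1 : Cay)) 0 := by
    rw [hat 0 0 (aff_mem_hyperbolicPlane.2 (by simp))]
    have : Real.sinh (Real.artanh (1 / 2)) * (Real.cosh (Real.artanh (1 / 2)))⁻¹ = 1 / 2 := by
      rw [← div_eq_mul_inv, ← Real.tanh_eq_sinh_div_cosh, Real.tanh_artanh (by norm_num)]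
    rw [smul_zero, smul_zero, zero_add, zero_add, inv_real_smul, inv_one', mul_real_smul_one,
      smul_smul, mul_comm, this, zero_mul]
  have hhalf : m (Point.aff ((1 / 2 : ℝ) • (1 : Cay)) 0) =
      Point.aff ((1 / 2 : ℝ) • (1 : Cay)) 0 := by
    rw [← ha0, ← Equiv.Perm.mul_apply, ← hcomm, Equiv.Perm.mul_apply, h0]
  obtain ⟨α, β, γ, haff, -, -⟩ := exists_autotopism_of_mem_G hG h0 half_smul_one_ne_zero hhalf
  have h1 : α ((1 / 2 : ℝ) • (1 : Cay)) = (1 / 2 : ℝ) • (1 : Cay) :=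
    (Point.aff.inj ((haff _ _).symm.trans hhalf)).1
  have e : (1 : Cay) = (1 / 2 : ℝ) • (1 : Cay) + (1 / 2 : ℝ) • (1 : Cay) := by
    rw [← add_smul]; norm_num
  have h2 : α 1 = 1 := by
    rw [e, map_add, h1]
  rw [haff, h2, map_zero]

/-- An additive map of the octonions that fixes `1`, preserves the real octonions and is
multiplicative on them is the identity there, because `ℝ` has no other ring endomorphism. -/
theorem map_smul_one_eq {f : Cay →+ Cay} (h1 : f 1 = 1)
    (hmul : ∀ r r' : ℝ, f ((r * r') • (1 : Cay)) = f (r • (1 : Cay)) * f (r' • (1 : Cay)))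
    (hreal : ∀ r : ℝ, conj (f (r • (1 : Cay))) = f (r • (1 : Cay))) (r : ℝ) :
    f (r • (1 : Cay)) = r • (1 : Cay) := by
  have hr : ∀ r : ℝ, f (r • (1 : Cay)) = f (r • (1 : Cay)) 0 • (1 : Cay) := fun r =>
    eq_smul_one_of_conj_eq (hreal r)
  let ρ : ℝ →+* ℝ :=
    { toFun := fun r => f (r • (1 : Cay)) 0
      map_one' := by rw [one_smul, h1]; simp [one_def, e]
      map_zero' := by simp
      map_add' := fun r r' => by simp [add_smul]
      map_mul' := fun r r' => by
        rw [hmul, hr r, hr r', mul_real_smul_one, smul_smul]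
        simp [one_def, e, mul_comm] }
  have hρ : ρ r = r := by rw [Subsingleton.elim ρ (RingHom.id ℝ), RingHom.id_apply]
  rw [hr r]
  exact congrArg (· • (1 : Cay)) hρ

/-- An automorphism fixing `(0, 0)` and `(1, 0)` is real-linear in each coordinate, respects the
octonion norm, and intertwines right multiplication and inversion. -/
theorem exists_linear_of_fixes {m : Equiv.Perm Point} (hG : m ∈ G)
    (h0 : m (Point.aff 0 0) = Point.aff 0 0) (h1 : m (Point.aff 1 0) = Point.aff 1 0) :
    ∃ α β : Cay →+ Cay, (∀ x y, m (Point.aff x y) = Point.aff (α x) (β y)) ∧ α 1 = 1 ∧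
      (∀ (r : ℝ) x, α (r • x) = r • α x) ∧ (∀ x, α x⁻¹ = (α x)⁻¹) ∧
      (∀ y x, β (y * x) = β y * α x) ∧ (∀ x, normSq (α x) = normSq x) ∧
      ∀ y, normSq (β y) = normSq y := by
  obtain ⟨α, β, γ, haff, -, hmul⟩ := exists_autotopism_of_mem_G hG h0 one_ne_zero h1
  have hα1 : α 1 = 1 := (Point.aff.inj ((haff _ _).symm.trans h1)).1
  have hβγ : ∀ u, β u = γ u := fun u => by simpa [hα1] using hmul u 1
  simp only [← hβγ] at hmul
  have hα0 : ∀ {x}, x ≠ 0 → α x ≠ 0 := fun {x} hx h => hx <| by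
    have : m (Point.aff x 0) = m (Point.aff 0 0) := by rw [haff, haff, h, map_zero α]
    simpa using m.injective this
  have hβ0 : ∀ {y}, y ≠ 0 → β y ≠ 0 := fun {y} hy h => hy <| by
    have : m (Point.aff 0 y) = m (Point.aff 0 0) := by rw [haff, haff, h, map_zero β]
    simpa using m.injective this
  have hb := hβ0 (one_ne_zero (α := Cay))
  have hinv : ∀ x, α x⁻¹ = (α x)⁻¹ := fun x => by
    rcases eq_or_ne x 0 with rfl | hx
    · simp
    apply eq_of_mul_left_eq hb
    rw [← mul_mul_inv (hα0 hx) (β 1 * α x⁻¹), ← hmul, ← hmul, mul_inv_mul hx]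
  have hpolar : ∀ {p q}, q ∈ polar p → m q ∈ polar (m p) := fun {p q} hq => by
    rw [← hG.2 p]; exact ⟨q, hq, rfl⟩
  have hconj : ∀ x, α (conj x) = conj (α x) := fun x => by
    rcases eq_or_ne x 0 with rfl | hx
    · simp
    have hx' : x⁻¹ ≠ 0 := by rwa [Ne, inv_eq_zero']
    have : Point.aff (conj x) 0 ∈ polar (Point.aff x⁻¹ 0) := by
      rw [polar_aff_zero hx', inv_inv']; simp
    have := hpolar this
    rwa [haff, haff, map_zero β, polar_aff_zero (hα0 hx'), aff_mem_vertical, hinv, inv_inv'] at this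
  have hβconj : ∀ {y}, y ≠ 0 → β (conj y⁻¹) = conj (β y)⁻¹ := fun {y} hy => by
    have : Point.aff 0 (conj y⁻¹) ∈ polar (Point.aff 0 y) := by
      rw [polar_aff hy]; simp
    have := hpolar this
    rw [haff, haff, map_zero α, polar_aff (hβ0 hy)] at this
    simpa using this
  -- Real scalars associate with everything, so `α` is multiplicative on them.
  have hαreal : ∀ r : ℝ, α (r • (1 : Cay)) = r • (1 : Cay) := by
    have hreal : ∀ r : ℝ, conj (α (r • (1 : Cay))) = α (r • (1 : Cay)) := fun r => by
      rw [← hconj, conj_smul, conj_one]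
    refine map_smul_one_eq hα1 (fun r r' => ?_) hreal
    have h := eq_smul_one_of_conj_eq (hreal r)
    apply eq_of_mul_left_eq hb
    have e : (1 : Cay) * ((r * r') • (1 : Cay)) = (1 * (r • (1 : Cay))) * (r' • (1 : Cay)) := by
      rw [mul_real_smul_one, mul_real_smul_one, mul_real_smul_one, smul_smul, mul_comm]
    rw [← hmul, e, hmul, hmul, h, mul_real_smul_one, smul_mul, smul_mul, one_mul, Cay.mul_smul]
  have hβlin : ∀ (r : ℝ) y, β (r • y) = r • β y := fun r y => by
    rw [← mul_real_smul_one y r, hmul, hαreal, mul_real_smul_one]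
  have hαlin : ∀ (r : ℝ) x, α (r • x) = r • α x := fun r x => by
    apply eq_of_mul_left_eq hb
    rw [← hmul, Cay.mul_smul, hβlin, hmul, Cay.mul_smul]
  refine ⟨α, β, haff, hα1, hαlin, hinv, hmul, fun x => ?_, fun y => ?_⟩
  · rcases eq_or_ne x 0 with rfl | hx
    · simp
    have h := hinv x
    rw [inv_def, inv_def, hαlin, hconj] at h
    exact (inv_injective (smul_left_injective ℝ (mt conj_eq_zero.1 (hα0 hx)) h)).symm
  · rcases eq_or_ne y 0 with rfl | hy
    · simp
    have h := hβconj hy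
    rw [inv_def, inv_def, conj_smul, conj_smul, conj_conj, conj_conj, hβlin] at h
    exact (inv_injective (smul_left_injective ℝ (hβ0 hy) h)).symm

theorem mem_M_of_fixes {m : Equiv.Perm Point} (hm : m ∈ K)
    (h1 : m (Point.aff 1 0) = Point.aff 1 0) : m ∈ M := by
  refine ⟨hm, ?_⟩
  rintro a ⟨ha, t, hat⟩
  obtain ⟨α, β, haff, hα1, hlin, hinv, hmul, hnα, hnβ⟩ := exists_linear_of_fixes hm.1 hm.2 h1
  -- The conjugate `m⁻¹ a m` acts on the hyperbolic plane as `a` does, so it is `a`.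
  have hconj : ActsAsA t (m⁻¹ * a * m) := fun x y hxy => by
    have hxy' : Point.aff (α x) (β y) ∈ hyperbolicPlane := by
      rw [aff_mem_hyperbolicPlane] at hxy ⊢
      rwa [hnα, hnβ]
    have hd : α (Real.sinh t • x + Real.cosh t • (1 : Cay)) =
        Real.sinh t • α x + Real.cosh t • (1 : Cay) := by
      rw [map_add, hlin, hlin, hα1]
    have hx : normSq x < 1 := by
      rw [aff_mem_hyperbolicPlane] at hxy
      linarith [normSq_nonneg y]
    have hne := smul_add_smul_one_ne_zero (Real.cosh_sq_sub_sinh_sq t) hx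
    have hne' := smul_add_smul_one_ne_zero (Real.cosh_sq_sub_sinh_sq t) ((hnα x).trans_lt hx)
    rw [Equiv.Perm.mul_apply, Equiv.Perm.mul_apply, Equiv.Perm.inv_eq_iff_eq, haff, haff,
      hat _ _ hxy', hmul, hinv, hd]
    congr 1
    rcases eq_or_ne (Real.sinh t) 0 with hs | hs
    · simp only [hs, zero_smul, zero_add, add_zero]
      rw [inv_real_smul, inv_one', mul_real_smul_one, mul_real_smul_one, hlin, hlin]
    · rw [mobius_eq hs (Real.cosh_sq_sub_sinh_sq t) hne,
        mobius_eq hs (Real.cosh_sq_sub_sinh_sq t) hne', map_add, hlin, hlin, hinv, hd, hα1]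
  have := ActsAsA.unique (mul_mem (mul_mem (inv_mem hm.1) ha) hm.1) ha hconj hat
  rw [mul_assoc, inv_mul_eq_iff_eq_mul] at this
  exact this

end OctonionPlane

theorem proposition4p4 :
    (∀ t : ℝ, ∃! a : Equiv.Perm OctonionPlane.Point,
      a ∈ OctonionPlane.G ∧ OctonionPlane.ActsAsA t a) ∧
    OctonionPlane.M =
      OctonionPlane.K ⊓
        MulAction.stabilizer (Equiv.Perm OctonionPlane.Point) (OctonionPlane.Point.aff 1 0) := by
  refine ⟨fun t => ?_, ?_⟩
  · obtain ⟨a, ha, hat⟩ := OctonionPlane.exists_actsAsA t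
    exact ⟨a, ⟨ha, hat⟩, fun b hb => OctonionPlane.ActsAsA.unique hb.1 ha hb.2 hat⟩
  · ext m
    exact ⟨fun hm => ⟨hm.1, OctonionPlane.stabilizer_of_mem_M hm⟩,
      fun hm => OctonionPlane.mem_M_of_fixes hm.1 hm.2⟩
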